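/- All graphs are finite, simple and undirected. For a graph $G$, a vertex $v \in V(G)$ and a set $U \subseteq V(G)$, let $E(v)$ denote the set of edges incident to $v$, and let $\mathrm{CFI}(G,U)$ be the graph with vertex set $$\{(v,S) \mid v \in V(G),\ S \subseteq E(v),\ |S| \equiv |\{v\} \cap U| \bmod 2\}$$ in which $(v,S)$ and $(u,T)$ are adjacent if and only if $vu \in E(G)$ and $vu \notin S \bigtriangleup T$. Let $k \ge 1$. The bijective $k$-pebble game on graphs $G_1$ and $G_2$ is played by Spoiler and Duplicator; its positions are pairs $(\bar v,\bar w) \in V(G_1)^k \times V(G_2)^k$. To determine the initial position, Duplicator plays a bijection $f\colon V(G_1)^k \to V(G_2)^k$, Spoiler chooses $\bar v \in V(G_1)^k$, and the initial position is $(\bar v, f(\bar v))$. In each round, with current position $(\bar v,\bar w)$, Spoiler chooses $i \in \{1,\dots,k\}$, Duplicator plays a bijection $f\colon V(G_1) \to V(G_2)$, Spoiler chooses $v \in V(G_1)$, and in the new position the $i$-th entry of $\bar v$ is replaced by $v$ and the $i$-th entry of $\bar w$ is replaced by $f(v)$. Spoiler wins the play if it reaches a position (the initial one included) at which there are $i,j$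 such that exactly one of $v_i = v_j$ and $w_i = w_j$ holds, or exactly one of $v_iv_j \in E(G_1)$ and $w_iw_j \in E(G_2)$ holds; Duplicator wins the play if no such position is reached. Duplicator wins the game if Duplicator has a winning strategy. Lemma. Let $k \ge 1$, let $G$ be a connected graph of tree-width at least $k$, and let $u \in V(G)$. Then Duplicator wins the bijective $k$-pebble game on $\mathrm{CFI}(G,\emptyset)$ and $\mathrm{CFI}(G,\{u\})$. -/

import Mathlib

namespace CFIGame

open SimpleGraph

/-! Tree-width -/

/-- A tree decomposition of `G` indexed by the nodes of a tree on the type `ι`. That every vertex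
lies in some bag is part of `connected`, since connected graphs are nonempty. -/
structure TreeDecomposition {V : Type*} (G : SimpleGraph V) (ι : Type*) where
  tree : SimpleGraph ι
  isTree : tree.IsTree
  bag : ι → Finset V
  edge_covered : ∀ u v : V, G.Adj u v → ∃ t : ι, u ∈ bag t ∧ v ∈ bag t
  connected : ∀ v : V, (tree.induce {t : ι | v ∈ bag t}).Connected

/-- The width of a tree decomposition: the maximal size of a bag, minus one. (A graph with at
least one vertex has a nonempty bag in each of its tree decompositions, so that the subtraction
is then a true one.) -/
def TreeDecomposition.width {V ι : Type*} [Fintype ι] {G : SimpleGraph V}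
    (D : TreeDecomposition G ι) : ℕ :=
  (Finset.univ.sup fun t : ι => (D.bag t).card) - 1

/-- The tree-width of `G`: the minimal width of a tree decomposition of `G` over a finite tree.
For finite `G` the trivial decomposition with one bag exists, so that this is a number. -/
noncomputable def treewidth {V : Type*} (G : SimpleGraph V) : ℕ∞ :=
  ⨅ (n : ℕ) (D : TreeDecomposition G (Fin n)), (D.width : ℕ∞)

/-! CFI graphs -/

/-- The vertices of `CFI(G,U)`: the pairs `(v,S)` where `S` is a set of edges incident to `v` and
`|S|` has the same parity as `|{v} ∩ U|`. -/
abbrev CFIVertex {V : Type*} [DecidableEq V] (G : SimpleGraph V) (U : Finset V) : Type _ :=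
  {p : V × Finset (Sym2 V) //
    (p.2 : Set (Sym2 V)) ⊆ G.incidenceSet p.1 ∧ Nat.ModEq 2 p.2.card ({p.1} ∩ U).card}

/-- The graph `CFI(G,U)`: `(v,S)` and `(u,T)` are adjacent if `uv` is an edge of `G` that does not
lie in the symmetric difference of `S` and `T`. -/
def CFI {V : Type*} [DecidableEq V] (G : SimpleGraph V) (U : Finset V) :
    SimpleGraph (CFIVertex G U) where
  Adj x y := G.Adj x.1.1 y.1.1 ∧ s(x.1.1, y.1.1) ∉ symmDiff x.1.2 y.1.2
  symm := ⟨fun x y h => ⟨h.1.symm, by rw [Sym2.eq_swap, symmDiff_comm]; exact h.2⟩⟩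
  loopless := ⟨fun x h => G.loopless.irrefl _ h.1⟩

/-! The bijective pebble game -/

/-- A strategy of Duplicator in the bijective `k`-pebble game on graphs with vertex types `V` and
`W`. `init` is the bijection played to determine the initial position. In a later round,
`move x l i` is the bijection played when Spoiler has started with the tuple `x`, has made the
moves `l` (most recent first) in the rounds so far, and has now chosen the index `i`. -/
structure DuplicatorStrategy (k : ℕ) (V W : Type*) where
  init : (Fin k → V) ≃ (Fin k → W)
  move : (Fin k → V) → List (Fin k × V) → Fin k → (V ≃ W)

/-- The position reached when Duplicator follows the strategy `σ`, Spoiler starts with the tuple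
`x`, and then makes the moves `l` (most recent first); a move consists of the index of a pebble
and of the vertex on which the pebble is placed. -/
def DuplicatorStrategy.position {k : ℕ} {V W : Type*} (σ : DuplicatorStrategy k V W)
    (x : Fin k → V) : List (Fin k × V) → (Fin k → V) × (Fin k → W)
  | [] => (x, σ.init x)
  | (i, v) :: l =>
      (Function.update (σ.position x l).1 i v,
        Function.update (σ.position x l).2 i (σ.move x l i v))

/-- Mapping `v i` to `w i` for all `i` is an isomorphism of the induced subgraphs; Spoiler wins at
the positions where this fails. -/
def IsLocalIso {k : ℕ} {V W : Type*} (G : SimpleGraph V) (H : SimpleGraph W)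
    (v : Fin k → V) (w : Fin k → W) : Prop :=
  ∀ i j : Fin k, (v i = v j ↔ w i = w j) ∧ (G.Adj (v i) (v j) ↔ H.Adj (w i) (w j))

/-- Duplicator wins the bijective `k`-pebble game on `G` and `H`: there is a strategy such that no
position that is reached in any play against it is won by Spoiler. -/
def DuplicatorWins {V W : Type*} (k : ℕ) (G : SimpleGraph V) (H : SimpleGraph W) : Prop :=
  ∃ σ : DuplicatorStrategy k V W, ∀ (x : Fin k → V) (l : List (Fin k × V)),
    IsLocalIso G H (σ.position x l).1 (σ.position x l).2

end CFIGame

/-!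
The proof plays a cops-and-robber game on `G` in parallel to the pebble game: the cops stand on the
vertices of `G` under the pebbles.

A set `Z` of edges of `G` acts on pairs `(v, S)` by exchanging the edges of `Z` at `v` (`twist`).
This respects the adjacency of the CFI graphs, and it maps vertices of `CFI(G,∅)` over `v` to
vertices of `CFI(G,{u})` over `v` if the degree of `v` in `Z` is odd exactly for `v = u`. By
the handshake lemma this fails for some `v`, but if `Z` is a walk from `u` to `w` modulo 2
(`IsJoin`), then it fails over `w` only. Duplicator maintains that the position is the twist by
such a set, where `w` is the current position of the robber. When a pebble is moved, the robber
runs from `w` to a vertex `w'` without meeting the pebbles that stay, and the edges of his path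
are added to `Z` modulo 2; this does not change the twist over the pebbles that stay. As `w'` may
depend on the vertex of `G` under the new pebble, Duplicator's bijection uses another twist over
every vertex of `G` (`twistEquiv`).

It remains to see that the robber escapes `k` cops (`exists_robber_of_le_treewidth`). This is the
hard direction of tree-width duality, which is proved in the way of Lyaudet, Mazoit and Thomassé,
in terms of partitions of the edges. The border of a partition is the set of the vertices that are
incident to edges of different classes. If all edges can be split up, by successive partitions with
borders of size at most `k`, into sets that are incident to at most `k` vertices (`Searchable`),
then the borders and the vertex sets of the leaves form a tree decomposition of width less than `k`
(`treewidth_le_of_searchable`). Otherwise, let `L` be a maximal lower set of edge sets, containing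
these small sets, such that the edges cannot be split up into members of `L`. Every partition with a
border of size at most `k` has a class outside `L`, and two sets outside `L` always intersect
(`exists_bramble_of_not_searchable`): if minimal sets `A` and `B` outside `L` were disjoint, then by
maximality there would be a search with leaves in `L` and `A`, and one with leaves in `L` and `B`;
rooted at `A` and `B` (`Searchable.reroot`), trimmed along a set of least border that separates `A`
from `B` (`Searchable.diff`), and joined there, they would be a search with leaves in `L`. Given
the cops' positions `X`, the robber now stays in the component of `G - X` for which the edges that
touch it form a set outside `L`.
-/

namespace CFIGame

open SimpleGraph

/-! ### Borders of edge sets and of edge partitions -/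

section Border

variable {V E ι : Type*}

/-- The border of a partition of the edges of a hypergraph, given by the colouring `p`: the
vertices that are incident to edges of different classes. -/
def partitionBorder (inc : V → E → Prop) (p : E → ι) : Set V :=
  {v | ∃ e f, inc v e ∧ inc v f ∧ p e ≠ p f}

/-- The border of a set `X` of edges: the vertices that are incident to an edge in `X` and to an
edge outside `X`. -/
def edgeBorder (inc : V → E → Prop) (X : Set E) : Set V :=
  {v | (∃ e ∈ X, inc v e) ∧ ∃ e ∉ X, inc v e}

variable {inc : V → E → Prop}

lemma edgeBorder_compl (X : Set E) : edgeBorder inc Xᶜ = edgeBorder inc X := by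
  ext v
  simp [edgeBorder, and_comm]

lemma edgeBorder_preimage_singleton_subset (p : E → ι) (i : ι) :
    edgeBorder inc (p ⁻¹' {i}) ⊆ partitionBorder inc p := by
  rintro v ⟨⟨e, he, hve⟩, f, hf, hvf⟩
  refine ⟨e, f, hve, hvf, fun h => hf ?_⟩
  rw [Set.mem_preimage, ← h]
  exact he

lemma partitionBorder_comp_of_injective {κ : Type*} {g : ι → κ} (hg : g.Injective) (p : E → ι) :
    partitionBorder inc (g ∘ p) = partitionBorder inc p := by
  ext v
  simp [partitionBorder, hg.eq_iff]

lemma ncard_add_ncard_le_of_union_of_inter [Finite V] {S T S' T' : Set V}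
    (h₁ : S ∪ T ⊆ S' ∪ T') (h₂ : S ∩ T ⊆ S' ∩ T') :
    S.ncard + T.ncard ≤ S'.ncard + T'.ncard := by
  rw [← Set.ncard_union_add_ncard_inter, ← Set.ncard_union_add_ncard_inter S']
  exact add_le_add (Set.ncard_le_ncard h₁) (Set.ncard_le_ncard h₂)

lemma ncard_edgeBorder_submodular [Finite V] (X Y : Set E) :
    (edgeBorder inc (X ∪ Y)).ncard + (edgeBorder inc (X ∩ Y)).ncard ≤
      (edgeBorder inc X).ncard + (edgeBorder inc Y).ncard := by
  apply ncard_add_ncard_le_of_union_of_inter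
  · rintro v (⟨⟨e, he, hve⟩, f, hf, hvf⟩ | ⟨⟨e, he, hve⟩, f, hf, hvf⟩)
    · rw [Set.mem_union, not_or] at hf
      exact he.imp (fun h => ⟨⟨e, h, hve⟩, f, hf.1, hvf⟩) fun h => ⟨⟨e, h, hve⟩, f, hf.2, hvf⟩
    · rw [Set.mem_inter_iff, not_and_or] at hf
      exact hf.imp (fun h => ⟨⟨e, he.1, hve⟩, f, h, hvf⟩) fun h => ⟨⟨e, he.2, hve⟩, f, h, hvf⟩
  · rintro v ⟨⟨-, f, hf, hvf⟩, ⟨e, he, hve⟩, -⟩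
    rw [Set.mem_union, not_or] at hf
    exact ⟨⟨⟨e, he.1, hve⟩, f, hf.1, hvf⟩, ⟨e, he.2, hve⟩, f, hf.2, hvf⟩

open Classical in
/-- Enlarging the class `p ⁻¹' {i}` by a set `F` does not enlarge the border of the partition if it
does not enlarge the border of that class. -/
lemma ncard_partitionBorder_piecewise_le [Finite V] (p : E → ι) (i : ι) (F : Set E)
    (h : (edgeBorder inc (p ⁻¹' {i} ∪ F)).ncard ≤ (edgeBorder inc (p ⁻¹' {i})).ncard) :
    (partitionBorder inc (F.piecewise (fun _ => i) p)).ncard ≤ (partitionBorder inc p).ncard := by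
  have key : (partitionBorder inc (F.piecewise (fun _ => i) p)).ncard +
      (edgeBorder inc (p ⁻¹' {i})).ncard ≤
      (partitionBorder inc p).ncard + (edgeBorder inc (p ⁻¹' {i} ∪ F)).ncard := by
    have hp := edgeBorder_preimage_singleton_subset (inc := inc) p i
    apply ncard_add_ncard_le_of_union_of_inter
    · rintro v (⟨e, f, hve, hvf, hef⟩ | hv)
      · by_cases he : e ∈ F <;> by_cases hf : f ∈ F
        · simp [he, hf] at hef
        · refine Or.inr ⟨⟨e, Or.inr he, hve⟩, f, ?_, hvf⟩
          simp only [he, hf, Set.piecewise_eq_of_mem, Set.piecewise_eq_of_notMem,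
            not_false_eq_true] at hef
          simp [hf, Ne.symm hef]
        · refine Or.inr ⟨⟨f, Or.inr hf, hvf⟩, e, ?_, hve⟩
          simp only [he, hf, Set.piecewise_eq_of_mem, Set.piecewise_eq_of_notMem,
            not_false_eq_true] at hef
          simp [he, hef]
        · refine Or.inl ⟨e, f, hve, hvf, ?_⟩
          simpa [he, hf] using hef
      · exact Or.inl (hp hv)
    · rintro v ⟨⟨e, f, hve, hvf, hef⟩, hv⟩
      refine ⟨hp hv, ?_⟩
      obtain ⟨⟨g, hg, hvg⟩, -⟩ := hv
      refine ⟨⟨g, Or.inl hg, hvg⟩, ?_⟩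
      by_contra! hc
      have hi : ∀ e, inc v e → F.piecewise (fun _ => i) p e = i := by
        intro e he
        by_cases heF : e ∈ F
        · simp [heF]
        · have : e ∈ p ⁻¹' {i} ∪ F := by
            by_contra h'
            exact hc e h' he
          simpa [heF] using this
      exact hef ((hi e hve).trans (hi f hvf).symm)
  omega

end Border

/-! ### Searches and brambles -/

section Search

variable {V E : Type*}

/-- `Searchable inc k S X` says that the set `X` of edges can be split up into sets in `S` by
repeatedly partitioning the current set of edges in such a way that the partition formed by its
classes and by the remaining edges has a border of size at most `k`. Partitions are given by
colourings with natural numbers, where the edges outside the current set have colour `0`. -/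
inductive Searchable (inc : V → E → Prop) (k : ℕ) (S : Set (Set E)) : Set E → Prop
  | leaf {X : Set E} (hX : X ∈ S) : Searchable inc k S X
  | node {X : Set E} (p : E → ℕ) (hX : ∀ e, p e = 0 ↔ e ∉ X)
      (hb : (partitionBorder inc p).ncard ≤ k)
      (h : ∀ i, i ≠ 0 → Searchable inc k S (p ⁻¹' {i})) : Searchable inc k S X

variable {inc : V → E → Prop} {k : ℕ} {S : Set (Set E)}

/-- A search that uses the set `A` as a leaf can be turned around, to start from `A`: either the
leaf `A` is not needed, or the tree of the search is rooted again at the leaf `A`. -/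
lemma Searchable.reroot [Finite V] {A X : Set E} (hA : A.Nonempty)
    (h : Searchable inc k (insert A S) X) :
    Searchable inc k S X ∨ (A ⊆ X ∧ (A = X ∨ (edgeBorder inc A).ncard ≤ k) ∧
      (Searchable inc k S Xᶜ → Searchable inc k S Aᶜ)) := by
  induction h with
  | @leaf X hX =>
    rcases hX with rfl | hX
    · exact Or.inr ⟨subset_rfl, Or.inl rfl, id⟩
    · exact Or.inl (.leaf hX)
  | @node X p hX hb _ ih =>
    by_cases hall : ∀ i, i ≠ 0 → Searchable inc k S (p ⁻¹' {i})
    · exact Or.inl (.node p hX hb hall)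
    push Not at hall
    obtain ⟨i, hi0, hi⟩ := hall
    obtain ⟨hAi, hAb, hAc⟩ := (ih i hi0).resolve_left hi
    refine Or.inr ⟨fun e he => ?_, Or.inr ?_, fun hXc => hAc ?_⟩
    · by_contra heX
      exact hi0 ((hAi he).symm.trans ((hX e).2 heX))
    · rcases hAb with rfl | hAb
      · exact (Set.ncard_le_ncard (edgeBorder_preimage_singleton_subset p i)).trans hb
      · exact hAb
    · -- The colours `0` and `i` exchange their roles.
      refine .node (Equiv.swap 0 i ∘ p) (fun e => ?_) ?_ fun j hj => ?_
      · simp [Equiv.swap_apply_eq_iff]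
      · rwa [partitionBorder_comp_of_injective (Equiv.swap 0 i).injective]
      · by_cases hji : j = i
        · subst hji
          convert hXc using 1
          ext e
          simp [Equiv.swap_apply_eq_iff, hX]
        · have hpre : (Equiv.swap 0 i ∘ p) ⁻¹' {j} = p ⁻¹' {j} := by
            ext e
            simp [Equiv.swap_apply_eq_iff, Equiv.swap_apply_of_ne_of_ne hj hji]
          rw [hpre]
          refine (ih j hj).resolve_right fun hAj => ?_
          obtain ⟨a, ha⟩ := hA
          exact hji ((hAj.1 ha).symm.trans (hAi ha))

open Classical in
/-- A set `F` that has the least border among its subsets containing `A` can be removed from every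
edge set that is searched and that avoids `A`. -/
lemma Searchable.diff [Finite V] {A F X : Set E} (hS : IsLowerSet S) (hAF : A ⊆ F)
    (hF : ∀ Y, A ⊆ Y → Y ⊆ F → (edgeBorder inc F).ncard ≤ (edgeBorder inc Y).ncard)
    (h : Searchable inc k S X) (hAX : Disjoint A X) : Searchable inc k S (X \ F) := by
  induction h with
  | leaf hX => exact .leaf (hS Set.sdiff_subset hX)
  | @node X p hX hb _ ih =>
    have hA0 : A ⊆ p ⁻¹' {0} := fun a ha => (hX a).2 (Set.disjoint_left.1 hAX ha)
    refine .node (F.piecewise (fun _ => 0) p) (fun e => ?_) (le_trans ?_ hb) fun i hi => ?_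
    · by_cases he : e ∈ F <;> simp [he, hX]
    · apply ncard_partitionBorder_piecewise_le
      have h₁ := ncard_edgeBorder_submodular (inc := inc) (p ⁻¹' {0}) F
      have h₂ := hF (p ⁻¹' {0} ∩ F) (Set.subset_inter hA0 hAF) Set.inter_subset_right
      omega
    · have hpre : F.piecewise (fun _ => 0) p ⁻¹' {i} = p ⁻¹' {i} \ F := by
        ext e
        by_cases he : e ∈ F <;> simp [he, Ne.symm hi]
      rw [hpre]
      refine ih i hi (Set.disjoint_left.2 fun a ha hai => hi ?_)
      exact hai.symm.trans (hA0 ha)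

lemma exists_minimal_notMem_subset [Finite E] {A : Set E} (hA : A ∉ S) :
    ∃ A' ⊆ A, A' ∉ S ∧ ∀ B, B ⊂ A' → B ∈ S := by
  obtain ⟨A', hle, hmin⟩ := exists_minimal_le_of_wellFoundedLT (fun A => A ∉ S) A hA
  refine ⟨A', hle, hmin.prop, fun B hB => ?_⟩
  by_contra hBS
  exact hB.2 (hmin.le_of_le hBS hB.1)

lemma isLowerSet_insert_of_forall_ssubset (hS : IsLowerSet S) {A : Set E}
    (hA : ∀ B, B ⊂ A → B ∈ S) : IsLowerSet (insert A S) := by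
  rintro X Y hYX (rfl | hX)
  · rcases eq_or_ssubset_of_subset hYX with rfl | h
    · exact Or.inl rfl
    · exact Or.inr (hA _ h)
  · exact Or.inr (hS hYX hX)

/-- If two disjoint sets `A` and `B` are such that adding either of them to `S` makes all edges
searchable, then all edges are searchable with `S` alone: the two searches are rooted at `A` and
at `B`, trimmed along a set `F` of least border between `A` and `Bᶜ`, and joined at `F`. -/
lemma searchable_univ_of_insert_of_insert [Finite V] [Finite E] {A B : Set E}
    (hS : IsLowerSet S) (h0 : ∅ ∈ S) (hA : A.Nonempty) (hB : B.Nonempty) (hAB : Disjoint A B)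
    (hSA : Searchable inc k (insert A S) Set.univ)
    (hSB : Searchable inc k (insert B S) Set.univ) : Searchable inc k S Set.univ := by
  rcases hSA.reroot hA with h | ⟨-, hAb, hAc⟩
  · exact h
  rcases hSB.reroot hB with h | ⟨-, -, hBc⟩
  · exact h
  have hempty : Searchable inc k S (Set.univ : Set E)ᶜ := by
    rw [Set.compl_univ]
    exact .leaf h0
  have hAc := hAc hempty
  have hBc := hBc hempty
  have hAk : (edgeBorder inc A).ncard ≤ k := by
    rcases hAb with rfl | h
    · exact absurd (Set.univ_disjoint.1 hAB) hB.ne_empty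
    · exact h
  obtain ⟨F, ⟨hAF, hFB⟩, hF⟩ := Set.exists_min_image {Y : Set E | A ⊆ Y ∧ Y ⊆ Bᶜ}
    (fun Y => (edgeBorder inc Y).ncard) (Set.toFinite _)
    ⟨A, subset_rfl, Set.subset_compl_iff_disjoint_right.2 hAB⟩
  have h₁ : Searchable inc k S (Aᶜ \ F) :=
    hAc.diff hS hAF (fun Y hAY hYF => hF Y ⟨hAY, hYF.trans hFB⟩) disjoint_compl_right
  have h₂ : Searchable inc k S (Bᶜ \ Fᶜ) := by
    refine hBc.diff hS (Set.subset_compl_comm.1 hFB) (fun Y hBY hYF => ?_) disjoint_compl_right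
    rw [edgeBorder_compl, ← edgeBorder_compl Y]
    exact hF Yᶜ ⟨hAF.trans (Set.subset_compl_comm.1 hYF), Set.compl_subset_compl.2 hBY⟩
  have e₁ : Aᶜ \ F = Fᶜ := by
    rw [Set.sdiff_eq, Set.inter_eq_right]
    exact Set.compl_subset_compl.2 hAF
  have e₂ : Bᶜ \ Fᶜ = F := by
    rw [Set.sdiff_compl, Set.inter_eq_right]
    exact hFB
  rw [e₁] at h₁
  rw [e₂] at h₂
  classical
  refine .node (fun e => if e ∈ F then 1 else 2) (fun e => ?_) ?_ fun i hi => ?_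
  · by_cases he : e ∈ F <;> simp [he]
  · refine (Set.ncard_le_ncard ?_).trans ((hF A ⟨subset_rfl, hAF.trans hFB⟩).trans hAk)
    rintro v ⟨e, f, hve, hvf, hef⟩
    by_cases he : e ∈ F <;> by_cases hf : f ∈ F
    · simp [he, hf] at hef
    · exact ⟨⟨e, he, hve⟩, f, hf, hvf⟩
    · exact ⟨⟨f, hf, hvf⟩, e, he, hve⟩
    · simp [he, hf] at hef
  · by_cases hi1 : i = 1
    · convert h₂ using 1
      ext e
      by_cases he : e ∈ F <;> simp [he, hi1]
    by_cases hi2 : i = 2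
    · convert h₁ using 1
      ext e
      by_cases he : e ∈ F <;> simp [he, hi2]
    · convert Searchable.leaf h0 using 1
      ext e
      by_cases he : e ∈ F <;> simp [he, Ne.symm hi1, Ne.symm hi2]

/-- The hard direction of tree-width duality: if the edges are not searchable with leaves in `S`,
then there is a bramble, a family of pairwise intersecting sets outside `S` that contains a class
of every partition of border at most `k`. It is the complement of a maximal lower set that contains
`S` and with which the edges are not searchable. -/
theorem exists_bramble_of_not_searchable [Finite V] [Finite E] (hS : IsLowerSet S) (h0 : ∅ ∈ S)
    (h : ¬ Searchable inc k S Set.univ) :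
    ∃ B : Set (Set E), IsUpperSet B ∧ Disjoint B S ∧
      (∀ X ∈ B, ∀ Y ∈ B, (X ∩ Y).Nonempty) ∧
      ∀ p : E → ℕ, (partitionBorder inc p).ncard ≤ k → ∃ i, p ⁻¹' {i} ∈ B := by
  obtain ⟨L, hSL, hL⟩ := exists_maximal_ge_of_wellFoundedGT
    (fun L : Set (Set E) => IsLowerSet L ∧ ¬ Searchable inc k L Set.univ) S ⟨hS, h⟩
  have hLl := hL.prop.1
  have hLs := hL.prop.2
  have h0L : ∅ ∈ L := hSL h0
  refine ⟨Lᶜ, hLl.compl, Set.disjoint_compl_left_iff_subset.2 hSL, fun X hX Y hY => ?_,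
    fun p hp => ?_⟩
  · rw [← Set.not_disjoint_iff_nonempty_inter]
    intro hXY
    obtain ⟨A, hAX, hA, hAmin⟩ := exists_minimal_notMem_subset hX
    obtain ⟨B, hBY, hB, hBmin⟩ := exists_minimal_notMem_subset hY
    have hins : ∀ A, A ∉ L → (∀ B, B ⊂ A → B ∈ L) →
        A.Nonempty ∧ Searchable inc k (insert A L) Set.univ := by
      intro A hA hAmin
      refine ⟨Set.nonempty_iff_ne_empty.2 fun h => hA (h ▸ h0L), ?_⟩
      by_contra hs
      exact hA (hL.le_of_ge ⟨isLowerSet_insert_of_forall_ssubset hLl hAmin, hs⟩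
        (Set.subset_insert A L) (Set.mem_insert A L))
    obtain ⟨hAn, hAs⟩ := hins A hA hAmin
    obtain ⟨hBn, hBs⟩ := hins B hB hBmin
    exact hLs (searchable_univ_of_insert_of_insert hLl h0L hAn hBn (hXY.mono hAX hBY) hAs hBs)
  · by_contra! hc
    refine hLs (.node (fun e => p e + 1) (by simp) ?_ fun i hi => .leaf ?_)
    · exact (partitionBorder_comp_of_injective (add_left_injective 1) p).symm ▸ hp
    · obtain ⟨j, rfl⟩ := Nat.exists_eq_succ_of_ne_zero hi
      have := hc j
      rw [Set.notMem_compl_iff] at this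
      convert this using 1
      ext e
      simp

end Search

/-! ### Tree decompositions from searches -/

section TreeBags

/-- The graph `T` with a new node attached to the node `t`. -/
def addLeaf {n : ℕ} (T : SimpleGraph (Fin n)) (t : Fin n) : SimpleGraph (Fin (n + 1)) :=
  T.map Fin.castSuccEmb ⊔ edge t.castSucc (Fin.last n)

variable {n : ℕ} {T : SimpleGraph (Fin n)} {t : Fin n}

lemma addLeaf_adj_castSucc (t : Fin n) {a b : Fin n} (h : T.Adj a b) :
    (addLeaf T t).Adj a.castSucc b.castSucc :=
  Or.inl (map_adj_apply (f := Fin.castSuccEmb).2 h)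

lemma addLeaf_adj_last (T : SimpleGraph (Fin n)) (t : Fin n) :
    (addLeaf T t).Adj t.castSucc (Fin.last n) :=
  Or.inr (by simp [edge_adj, Fin.ext_iff, t.2.ne])

lemma preconnected_induce_addLeaf {R : Set (Fin (n + 1))}
    (hR : (T.induce (Fin.castSucc ⁻¹' R)).Preconnected)
    (hl : Fin.last n ∈ R → ∀ s : Fin n, s.castSucc ∈ R → t.castSucc ∈ R) :
    ((addLeaf T t).induce R).Preconnected := by
  have old : ∀ (a b : Fin n) (ha : a.castSucc ∈ R) (hb : b.castSucc ∈ R),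
      ((addLeaf T t).induce R).Reachable ⟨_, ha⟩ ⟨_, hb⟩ := fun a b ha hb =>
    (hR ⟨a, ha⟩ ⟨b, hb⟩).map (induceHom (s := Fin.castSucc ⁻¹' R) (t := R)
      ⟨Fin.castSucc, fun h => addLeaf_adj_castSucc t h⟩ fun _ h => h)
  have new : ∀ (a : Fin n) (ha : a.castSucc ∈ R) (hb : Fin.last n ∈ R),
      ((addLeaf T t).induce R).Reachable ⟨_, ha⟩ ⟨_, hb⟩ := fun a ha hb =>
    (old a t ha (hl hb a ha)).trans
      (Adj.reachable (show (addLeaf T t).Adj _ _ from addLeaf_adj_last T t))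
  rintro ⟨a, ha⟩ ⟨b, hb⟩
  induction a using Fin.lastCases with
  | last =>
    induction b using Fin.lastCases with
    | last => rfl
    | cast b => exact (new b hb ha).symm
  | cast a =>
    induction b using Fin.lastCases with
    | last => exact new a ha hb
    | cast b => exact old a b ha hb

lemma isTree_addLeaf (hT : T.IsTree) : (addLeaf T t).IsTree := by
  obtain ⟨hc, hcard⟩ := isTree_iff_connected_and_card.1 hT
  rw [isTree_iff_connected_and_card]
  constructor
  · have : Nonempty (Fin (n + 1)) := ⟨t.castSucc⟩
    refine ⟨induceUnivIso (addLeaf T t) |>.preconnected_iff.1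
      (preconnected_induce_addLeaf ?_ fun _ _ _ => Set.mem_univ _)⟩
    rw [Set.preimage_univ]
    exact (induceUnivIso T).preconnected_iff.2 hc.preconnected
  · have hne : t.castSucc ≠ Fin.last n := (Fin.castSucc_lt_last t).ne
    rw [Nat.card_coe_set_eq] at hcard ⊢
    rw [addLeaf, edgeSet_sup, edgeSet_edge_of_ne hne, edgeSet_map, Set.union_singleton,
      Set.ncard_insert_of_notMem, Set.ncard_image_of_injective _ (Function.Embedding.injective _),
      hcard]
    · simp
    · rintro ⟨e, -, he⟩
      have hl : Fin.last n ∈ Sym2.map Fin.castSucc e := by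
        have : Sym2.map Fin.castSucc e = s(t.castSucc, Fin.last n) := he
        rw [this]
        exact Sym2.mem_mk_right _ _
      obtain ⟨a, -, ha⟩ := Sym2.mem_map.1 hl
      exact (Fin.castSucc_lt_last a).ne ha

variable {V : Type*}

/-- `IsTreeBags 𝓑` says that `𝓑` is the family of the bags of a tree such that the nodes whose bags
contain a given vertex always induce a connected subtree. -/
def IsTreeBags (𝓑 : Set (Finset V)) : Prop :=
  ∃ (n : ℕ) (T : SimpleGraph (Fin n)) (bag : Fin n → Finset V),
    T.IsTree ∧ (∀ v, (T.induce {t | v ∈ bag t}).Preconnected) ∧ Set.range bag = 𝓑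

lemma isTreeBags_singleton (A : Finset V) : IsTreeBags {A} :=
  ⟨1, ⊥, fun _ => A, .of_subsingleton,
    fun _ a b => by rw [Subsingleton.elim a b], Set.range_const⟩

lemma IsTreeBags.insert_bag {𝓑 : Set (Finset V)} (h : IsTreeBags 𝓑) {A B : Finset V} (hA : A ∈ 𝓑)
    (hB : ∀ v ∈ B, ∀ C ∈ 𝓑, v ∈ C → v ∈ A) : IsTreeBags (insert B 𝓑) := by
  obtain ⟨n, T, bag, hT, hc, rfl⟩ := h
  obtain ⟨t, rfl⟩ := hA
  refine ⟨n + 1, addLeaf T t, Fin.snoc (α := fun _ => Finset V) bag B, isTree_addLeaf hT,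
    fun v => ?_, Fin.range_snoc _ _⟩
  apply preconnected_induce_addLeaf
  · have hR : Fin.castSucc ⁻¹' {s | v ∈ Fin.snoc (α := fun _ => Finset V) bag B s} =
        {s | v ∈ bag s} := by
      ext s
      simp
    rw [hR]
    exact hc v
  · intro hl s hs
    simp only [Set.mem_ofPred_eq, Fin.snoc_last, Fin.snoc_castSucc] at hl hs ⊢
    exact hB v hl _ ⟨s, rfl⟩ hs

variable {E : Type*} {inc : V → E → Prop} {k : ℕ}

/-- The edge sets that are incident to at most `k` vertices. -/
def smallEdgeSets (inc : V → E → Prop) (k : ℕ) : Set (Set E) :=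
  {X | {v | ∃ e ∈ X, inc v e}.ncard ≤ k}

lemma isLowerSet_smallEdgeSets [Finite V] : IsLowerSet (smallEdgeSets inc k) := by
  intro X Y hYX hX
  refine (Set.ncard_le_ncard ?_).trans hX
  rintro v ⟨e, he, hve⟩
  exact ⟨e, hYX he, hve⟩

lemma empty_mem_smallEdgeSets : ∅ ∈ smallEdgeSets inc k := by
  simp [smallEdgeSets]

/-- Along a search, a tree of bags is grown: given a tree of bags for the edges outside `X`, one
of whose bags contains the vertices that are shared with `X`, it is extended to cover `X`. The bags
that are added are the borders of the partitions in the search, and the vertex sets of its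
leaves. -/
lemma Searchable.exists_isTreeBags [Fintype V] [Finite E] {X : Set E}
    (h : Searchable inc k (smallEdgeSets inc k) X) :
    ∀ (𝓑 : Set (Finset V)) (A : Finset V), IsTreeBags 𝓑 → A ∈ 𝓑 → (∀ C ∈ 𝓑, C.card ≤ k) →
      (∀ C ∈ 𝓑, ∀ v ∈ C, (∃ e ∈ X, inc v e) → v ∈ A ∧ ∃ e ∉ X, inc v e) →
      ∃ 𝓑', 𝓑 ⊆ 𝓑' ∧ IsTreeBags 𝓑' ∧ (∀ C ∈ 𝓑', C.card ≤ k) ∧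
        (∀ C ∈ 𝓑', ∀ v ∈ C, (∃ e ∈ X, inc v e) ∨ ∃ D ∈ 𝓑, v ∈ D) ∧
        ∀ e ∈ X, ∃ C ∈ 𝓑', ∀ v, inc v e → v ∈ C := by
  classical
  induction h with
  | @leaf X hX =>
    intro 𝓑 A h𝓑 hA hk hv
    refine ⟨insert {v | ∃ e ∈ X, inc v e}.toFinset 𝓑, Set.subset_insert _ _,
      h𝓑.insert_bag hA ?_, ?_, ?_, fun e he => ⟨_, Set.mem_insert _ _, fun v hve => ?_⟩⟩
    · intro v hvX C hC hvC
      exact (hv C hC v hvC (by simpa using hvX)).1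
    · rintro C (rfl | hC)
      · rw [← Set.ncard_eq_toFinset_card']
        exact hX
      · exact hk C hC
    · rintro C (rfl | hC) v hvC
      · exact Or.inl (by simpa using hvC)
      · exact Or.inr ⟨C, hC, hvC⟩
    · simpa using ⟨e, he, hve⟩
  | @node X p hX hb _ ih =>
    intro 𝓑 A h𝓑 hA hk hv
    set B : Finset V := {v | v ∈ partitionBorder inc p ∧ ∃ e ∈ X, inc v e} with hB
    have memB : ∀ v, v ∈ B ↔ v ∈ partitionBorder inc p ∧ ∃ e ∈ X, inc v e := by simp [hB]
    -- The parts of the partition are covered one after the other.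
    have key : ∀ s : Finset ℕ, ∃ 𝓑', insert B 𝓑 ⊆ 𝓑' ∧ IsTreeBags 𝓑' ∧
        (∀ C ∈ 𝓑', C.card ≤ k) ∧
        (∀ C ∈ 𝓑', ∀ v ∈ C, (∃ e, p e ∈ s ∧ e ∈ X ∧ inc v e) ∨ v ∈ B ∨ ∃ D ∈ 𝓑, v ∈ D) ∧
        ∀ e ∈ X, p e ∈ s → ∃ C ∈ 𝓑', ∀ v, inc v e → v ∈ C := by
      intro s
      induction s using Finset.induction_on with
      | empty =>
        refine ⟨insert B 𝓑, subset_rfl, h𝓑.insert_bag hA ?_, ?_, ?_, by simp⟩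
        · intro v hvB C hC hvC
          exact (hv C hC v hvC ((memB v).1 hvB).2).1
        · rintro C (rfl | hC)
          · rw [← Set.ncard_coe_finset]
            exact (Set.ncard_le_ncard fun v hv => ((memB v).1 hv).1).trans hb
          · exact hk C hC
        · rintro C (rfl | hC) v hvC
          · exact Or.inr (Or.inl hvC)
          · exact Or.inr (Or.inr ⟨C, hC, hvC⟩)
      | insert i s his IH =>
        obtain ⟨𝓑₁, hsub, htree, hk₁, hv₁, hcov⟩ := IH
        by_cases hi : i = 0
        · refine ⟨𝓑₁, hsub, htree, hk₁, fun C hC v hvC => ?_, fun e heX he => ?_⟩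
          · refine (hv₁ C hC v hvC).imp_left ?_
            rintro ⟨e, he, h⟩
            exact ⟨e, Finset.mem_insert_of_mem he, h⟩
          · refine hcov e heX ((Finset.mem_insert.1 he).resolve_left fun h => ?_)
            exact (hX e).1 (h.trans hi) heX
        have hXi : ∀ e, p e = i → e ∈ X := fun e he => by
          by_contra heX
          exact hi (he.symm.trans ((hX e).2 heX))
        obtain ⟨𝓑₂, hsub₂, htree₂, hk₂, hv₂, hcov₂⟩ :=
          ih i hi 𝓑₁ B htree (hsub (Set.mem_insert _ _)) hk₁ (by
            rintro C hC v hvC ⟨e, he, hve⟩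
            have he : p e = i := he
            suffices h : ∃ f, p f ≠ i ∧ inc v f by
              obtain ⟨f, hf, hvf⟩ := h
              refine ⟨(memB v).2 ⟨⟨e, f, hve, hvf, ?_⟩, e, hXi e he, hve⟩, f, hf, hvf⟩
              rw [he]
              exact hf.symm
            rcases hv₁ C hC v hvC with ⟨f, hf, -, hvf⟩ | hvB | ⟨D, hD, hvD⟩
            · exact ⟨f, fun h => his (h ▸ hf), hvf⟩
            · obtain ⟨f, g, hvf, hvg, hfg⟩ := ((memB v).1 hvB).1
              by_cases hf : p f = i
              · exact ⟨g, fun hg => hfg (hf.trans hg.symm), hvg⟩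
              · exact ⟨f, hf, hvf⟩
            · obtain ⟨f, hf, hvf⟩ := (hv D hD v hvD ⟨e, hXi e he, hve⟩).2
              exact ⟨f, fun h => hf (hXi f h), hvf⟩)
        refine ⟨𝓑₂, hsub.trans hsub₂, htree₂, hk₂, fun C hC v hvC => ?_, fun e heX he => ?_⟩
        · rcases hv₂ C hC v hvC with ⟨e, he, hve⟩ | ⟨D, hD, hvD⟩
          · have he : p e = i := he
            exact Or.inl ⟨e, by simp [he], hXi e he, hve⟩
          · refine (hv₁ D hD v hvD).imp_left ?_
            rintro ⟨e, he, h⟩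
            exact ⟨e, Finset.mem_insert_of_mem he, h⟩
        · rcases Finset.mem_insert.1 he with he | he
          · exact hcov₂ e he
          · obtain ⟨C, hC, h⟩ := hcov e heX he
            exact ⟨C, hsub₂ hC, h⟩
    obtain ⟨𝓑', hsub, htree, hk', hv', hcov⟩ := key (Set.finite_range p).toFinset
    refine ⟨𝓑', (Set.subset_insert _ _).trans hsub, htree, hk', fun C hC v hvC => ?_,
      fun e he => hcov e he (by simp)⟩
    rcases hv' C hC v hvC with ⟨e, -, he⟩ | hvB | h
    · exact Or.inl ⟨e, he⟩
    · exact Or.inl ((memB v).1 hvB).2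
    · exact Or.inr h

/-- If the edges of a graph without isolated vertices are searchable with borders and leaves of at
most `k` vertices, then the tree-width is at most `k - 1`. -/
theorem treewidth_le_of_searchable [Fintype V] {G : SimpleGraph V} (hG : ∀ v, ∃ w, G.Adj v w)
    (h : Searchable (fun v (e : G.edgeSet) => v ∈ e.1) k
      (smallEdgeSets (fun v (e : G.edgeSet) => v ∈ e.1) k) Set.univ) :
    treewidth G ≤ (k - 1 : ℕ) := by
  obtain ⟨𝓑, -, ⟨n, T, bag, hT, hc, rfl⟩, hk, -, hcov⟩ := h.exists_isTreeBags {∅} ∅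
    (isTreeBags_singleton ∅) rfl (by simp) (by simp)
  have hcov' : ∀ u v : V, G.Adj u v → ∃ t, u ∈ bag t ∧ v ∈ bag t := by
    intro u v huv
    obtain ⟨-, ⟨t, rfl⟩, ht⟩ := hcov ⟨s(u, v), huv⟩ trivial
    exact ⟨t, ht u (Sym2.mem_mk_left u v), ht v (Sym2.mem_mk_right u v)⟩
  let D : TreeDecomposition G (Fin n) :=
    { tree := T
      isTree := hT
      bag := bag
      edge_covered := hcov'
      connected := fun v => by
        obtain ⟨w, hw⟩ := hG v
        obtain ⟨t, ht, -⟩ := hcov' v w hw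
        have : Nonempty {t | v ∈ bag t} := ⟨⟨t, ht⟩⟩
        exact ⟨hc v⟩ }
  refine iInf₂_le_of_le n D (Nat.cast_le.2 (Nat.sub_le_sub_right ?_ 1))
  exact Finset.sup_le fun t _ => hk _ ⟨t, rfl⟩

end TreeBags

/-! ### The robber's strategy -/

section Robber

variable {V : Type*}

lemma treewidth_le_card_sub_one [Fintype V] (G : SimpleGraph V) :
    treewidth G ≤ (Fintype.card V - 1 : ℕ) := by
  let D : TreeDecomposition G (Fin 1) :=
    { tree := ⊥
      isTree := .of_subsingleton
      bag := fun _ => Finset.univ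
      edge_covered := fun u v _ => ⟨0, Finset.mem_univ u, Finset.mem_univ v⟩
      connected := fun v => by
        have : Nonempty {t : Fin 1 | v ∈ (Finset.univ : Finset V)} := ⟨⟨0, Finset.mem_univ v⟩⟩
        exact ⟨fun a b => by rw [Subsingleton.elim a b]⟩ }
  refine iInf₂_le_of_le 1 D (Nat.cast_le.2 (Nat.sub_le_sub_right ?_ 1))
  exact Finset.sup_le fun t _ => le_rfl

/-- `ReachableAvoiding G X a b` says that `b` can be reached from `a` by a walk in `G` all of whose
edges have both ends outside `X`. -/
def ReachableAvoiding (G : SimpleGraph V) (X : Finset V) : V → V → Prop :=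
  Relation.ReflTransGen fun a b => G.Adj a b ∧ a ∉ X ∧ b ∉ X

variable {G : SimpleGraph V} {X Y : Finset V}

lemma ReachableAvoiding.symm {a b : V} (h : ReachableAvoiding G X a b) :
    ReachableAvoiding G X b a := by
  have : Std.Symm fun a b => G.Adj a b ∧ a ∉ X ∧ b ∉ X :=
    ⟨fun _ _ h => ⟨h.1.symm, h.2.2, h.2.1⟩⟩
  exact Relation.ReflTransGen.stdSymm.symm _ _ h

lemma ReachableAvoiding.mono {a b : V} (hXY : X ⊆ Y) (h : ReachableAvoiding G Y a b) :
    ReachableAvoiding G X a b :=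
  Relation.ReflTransGen.mono
    (fun _ _ h => ⟨h.1, fun h' => h.2.1 (hXY h'), fun h' => h.2.2 (hXY h')⟩) a b h

lemma reachableAvoiding_empty_of_reachable {a b : V} (h : G.Reachable a b) :
    ReachableAvoiding G ∅ a b := by
  rw [reachable_iff_reflTransGen] at h
  exact Relation.ReflTransGen.mono
    (fun _ _ h => ⟨h, Finset.notMem_empty _, Finset.notMem_empty _⟩) a b h

/-- The vertices that can be reached from an end of the edge `e` outside `X`: the vertex set of the
component of `G - X` that `e` touches, or the empty set if both ends of `e` lie in `X`. -/
def componentOf (G : SimpleGraph V) (X : Finset V) (e : Sym2 V) : Set V :=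
  {x | ∃ y ∈ e, y ∉ X ∧ ReachableAvoiding G X y x}

lemma componentOf_eq {e : Sym2 V} (he : e ∈ G.edgeSet) {y : V} (hy : y ∈ e) (hyX : y ∉ X) :
    componentOf G X e = {x | ReachableAvoiding G X y x} := by
  ext x
  refine ⟨?_, fun h => ⟨y, hy, hyX, h⟩⟩
  rintro ⟨z, hz, hzX, h⟩
  by_cases hyz : y = z
  · exact hyz ▸ h
  · have hadj : G.Adj y z := by
      rw [(Sym2.mem_and_mem_iff hyz).1 ⟨hy, hz⟩] at he
      exact he
    exact Relation.ReflTransGen.head ⟨hadj, hyX, hzX⟩ h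

lemma partitionBorder_componentOf_subset :
    partitionBorder (fun v (e : G.edgeSet) => v ∈ e.1) (fun e : G.edgeSet => componentOf G X e.1) ⊆
      X := by
  rintro v ⟨e, f, hve, hvf, hef⟩
  by_contra hv
  exact hef ((componentOf_eq e.2 hve hv).trans (componentOf_eq f.2 hvf hv).symm)

/-- In a graph of tree-width at least `k`, a robber can forever escape `k` cops: there is a
position `β X` of the robber for every set `X` of at most `k` cops, such that the robber can move
between the positions for `X` and for a larger set of cops without meeting the cops in `X`. -/
theorem exists_robber_of_le_treewidth [Fintype V] (hG : G.Connected) {k : ℕ} (hk : 1 ≤ k)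
    (htw : (k : ℕ∞) ≤ treewidth G) :
    ∃ β : Finset V → V, (∀ X, X.card ≤ k → β X ∉ X) ∧
      ∀ X Y, X ⊆ Y → Y.card ≤ k → ReachableAvoiding G X (β X) (β Y) := by
  have hlt : ((k - 1 : ℕ) : ℕ∞) < treewidth G :=
    (Nat.cast_lt.2 (Nat.sub_one_lt (by omega))).trans_le htw
  have : Nontrivial V := by
    by_contra hV
    rw [not_nontrivial_iff_subsingleton, ← Fintype.card_le_one_iff_subsingleton] at hV
    have h := Nat.cast_le.1 (htw.trans (treewidth_le_card_sub_one G))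
    omega
  set inc : V → G.edgeSet → Prop := fun v e => v ∈ e.1 with hinc
  have hns : ¬ Searchable inc k (smallEdgeSets inc k) Set.univ := fun h =>
    hlt.not_ge (treewidth_le_of_searchable (fun v => hG.preconnected.exists_adj_of_nontrivial v) h)
  obtain ⟨B, hBup, hBS, hBint, hB⟩ :=
    exists_bramble_of_not_searchable isLowerSet_smallEdgeSets empty_mem_smallEdgeSets hns
  obtain ⟨g, hg⟩ := exists_injective_nat (Set V)
  -- The edges that touch the component of `y` in `G - X`.
  set R : Finset V → V → Set G.edgeSet :=
    fun X y => {e | componentOf G X e.1 = {x | ReachableAvoiding G X y x}} with hR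
  have hβ : ∀ X : Finset V, ∃ y, X.card ≤ k → y ∉ X ∧ R X y ∈ B := by
    intro X
    by_cases hX : X.card ≤ k
    swap
    · exact ⟨hG.nonempty.some, fun h => absurd h hX⟩
    obtain ⟨i, hi⟩ := hB (g ∘ fun e => componentOf G X e.1) (by
      rw [partitionBorder_comp_of_injective hg]
      refine (Set.ncard_le_ncard partitionBorder_componentOf_subset).trans ?_
      rwa [Set.ncard_coe_finset])
    -- The class in the bramble is not small, so that one of its edges has an end outside `X`.
    have hsmall := Set.disjoint_left.1 hBS hi
    obtain ⟨y, ⟨e, he, hye⟩, hyX⟩ : ∃ y, (∃ e ∈ (g ∘ fun e : G.edgeSet => componentOf G X e.1) ⁻¹'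
        {i}, inc y e) ∧ y ∉ X := by
      by_contra! hc
      refine hsmall ((Set.ncard_le_ncard (t := (X : Set V)) fun v hv => hc v hv).trans ?_)
      rwa [Set.ncard_coe_finset]
    refine ⟨y, fun _ => ⟨hyX, ?_⟩⟩
    convert hi using 1
    ext f
    have he : g (componentOf G X e.1) = i := he
    rw [hR, Set.mem_preimage, Set.mem_singleton_iff, Function.comp_apply, ← he, hg.eq_iff,
      componentOf_eq e.2 hye hyX]
    rfl
  choose β hβ using hβ
  refine ⟨β, fun X hX => (hβ X hX).1, fun X Y hXY hY => ?_⟩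
  have hX := (Finset.card_le_card hXY).trans hY
  -- Both positions touch a common edge, which has an end outside `Y` in the component of `β Y`.
  obtain ⟨e, heX, heY⟩ := hBint _ (hβ X hX).2 _ (hβ Y hY).2
  have heX : componentOf G X e.1 = {x | ReachableAvoiding G X (β X) x} := heX
  have heY : componentOf G Y e.1 = {x | ReachableAvoiding G Y (β Y) x} := heY
  obtain ⟨z, hz, hzY, hzr⟩ : β Y ∈ componentOf G Y e.1 := heY ▸ Relation.ReflTransGen.refl
  have : β Y ∈ componentOf G X e.1 := ⟨z, hz, fun h => hzY (hXY h), hzr.mono hXY⟩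
  exact (heX ▸ this : β Y ∈ {x | ReachableAvoiding G X (β X) x})

end Robber

/-! ### Strategies from invariants -/

section Invariant

variable {A B : Type*} {k : ℕ}

/-- Duplicator wins if there is an invariant of the positions that implies that Spoiler has not won,
that holds for all initial positions after some bijection of the tuples, and that Duplicator can
maintain in each round. -/
theorem duplicatorWins_of_invariant (G : SimpleGraph A) (H : SimpleGraph B)
    (I : (Fin k → A) → (Fin k → B) → Prop) (hI : ∀ x y, I x y → IsLocalIso G H x y)
    (init : (Fin k → A) ≃ (Fin k → B)) (h0 : ∀ x, I x (init x))
    (step : ∀ x y, I x y → ∀ i, ∃ f : A ≃ B,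
      ∀ a, I (Function.update x i a) (Function.update y i (f a))) :
    DuplicatorWins k G H := by
  choose f hf using step
  let pos (x : Fin k → A) (l : List (Fin k × A)) :
      {p : (Fin k → A) × (Fin k → B) // I p.1 p.2} :=
    l.rec ⟨(x, init x), h0 x⟩ fun m _ p =>
      ⟨(Function.update p.1.1 m.1 m.2, Function.update p.1.2 m.1 (f _ _ p.2 m.1 m.2)),
        hf _ _ p.2 m.1 m.2⟩
  let σ : DuplicatorStrategy k A B := ⟨init, fun x l i => f _ _ (pos x l).2 i⟩
  have hσ : ∀ x l, σ.position x l = (pos x l).1 := by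
    intro x l
    induction l with
    | nil => rfl
    | cons m l ih =>
      rw [DuplicatorStrategy.position, ih]
  refine ⟨σ, fun x l => ?_⟩
  rw [hσ]
  exact hI _ _ (pos x l).2

end Invariant

/-! ### Twisting CFI graphs -/

section Twist

variable {V : Type*} [DecidableEq V]

/-- The edges in `Z` that are incident to `v`. -/
def edgesAt (Z : Finset (Sym2 V)) (v : V) : Finset (Sym2 V) :=
  Z.filter (v ∈ ·)

lemma edgesAt_symmDiff (Z Z' : Finset (Sym2 V)) (v : V) :
    edgesAt (symmDiff Z Z') v = symmDiff (edgesAt Z v) (edgesAt Z' v) := by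
  ext e
  simp only [edgesAt, Finset.mem_filter, Finset.mem_symmDiff]
  tauto

lemma natCast_card_symmDiff {α : Type*} [DecidableEq α] (S T : Finset α) :
    ((symmDiff S T).card : ZMod 2) = S.card + T.card := by
  have h₁ : (symmDiff S T).card = (S \ T).card + (T \ S).card :=
    Finset.card_union_of_disjoint disjoint_sdiff_sdiff
  have h₂ := Finset.card_sdiff_add_card_inter S T
  have h₃ := Finset.card_sdiff_add_card_inter T S
  rw [h₁, ← h₂, ← h₃, Finset.inter_comm T S]
  push_cast
  linear_combination -((S ∩ T).card : ZMod 2) * (CharTwo.two_eq_zero (R := ZMod 2))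

/-- `Z` is a set of edges of `G` that looks like a walk from `a` to `b` modulo 2: the vertices of
odd degree in `Z` are `a` and `b` if `a ≠ b`, and there are none if `a = b`. -/
def IsJoin (G : SimpleGraph V) (Z : Finset (Sym2 V)) (a b : V) : Prop :=
  (Z : Set (Sym2 V)) ⊆ G.edgeSet ∧
    ∀ v, ((edgesAt Z v).card : ZMod 2) = (if v = a then 1 else 0) + (if v = b then 1 else 0)

variable {G : SimpleGraph V} {a b c u : V} {X : Finset V}

lemma IsJoin.symmDiff {Z Z' : Finset (Sym2 V)} (h : IsJoin G Z a b) (h' : IsJoin G Z' b c) :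
    IsJoin G (symmDiff Z Z') a c := by
  refine ⟨fun e he => ?_, fun v => ?_⟩
  · rcases Finset.mem_symmDiff.1 he with he | he
    · exact h.1 he.1
    · exact h'.1 he.1
  · rw [edgesAt_symmDiff, natCast_card_symmDiff, h.2, h'.2, add_assoc, CharTwo.add_cancel_left]

lemma isJoin_empty (G : SimpleGraph V) (a : V) : IsJoin G ∅ a a := by
  refine ⟨by simp, fun v => ?_⟩
  rw [CharTwo.add_self_eq_zero]
  simp [edgesAt]

lemma isJoin_singleton (h : G.Adj a b) : IsJoin G {s(a, b)} a b := by
  refine ⟨by simpa using h, fun v => ?_⟩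
  have hab := h.ne
  by_cases ha : v = a
  · subst ha
    simp [edgesAt, Finset.filter_singleton, hab]
  · by_cases hb : v = b <;> simp [edgesAt, Finset.filter_singleton, ha, hb, hab.symm]

lemma ReachableAvoiding.exists_isJoin (h : ReachableAvoiding G X a b) :
    ∃ Z, IsJoin G Z a b ∧ ∀ x ∈ X, edgesAt Z x = ∅ := by
  induction h with
  | refl => exact ⟨∅, isJoin_empty G a, fun _ _ => rfl⟩
  | @tail b c _ hbc ih =>
    obtain ⟨Z, hZ, hZX⟩ := ih
    refine ⟨_, hZ.symmDiff (isJoin_singleton hbc.1), fun x hx => ?_⟩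
    have hxb : x ≠ b := fun h => hbc.2.1 (h ▸ hx)
    have hxc : x ≠ c := fun h => hbc.2.2 (h ▸ hx)
    rw [edgesAt_symmDiff, hZX x hx]
    simp [edgesAt, Finset.filter_singleton, hxb, hxc]

/-- The map that exchanges, at the vertex `v` of the base graph, the edges in `Z` that are incident
to `v`. -/
def twist (Z : Finset (Sym2 V)) (p : V × Finset (Sym2 V)) : V × Finset (Sym2 V) :=
  (p.1, symmDiff p.2 (edgesAt Z p.1))

lemma twist_involutive (Z : Finset (Sym2 V)) : Function.Involutive (twist Z) := fun p => by
  simp [twist]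

lemma twist_congr {Z Z' : Finset (Sym2 V)} {p : V × Finset (Sym2 V)}
    (h : edgesAt Z p.1 = edgesAt Z' p.1) : twist Z p = twist Z' p := by
  rw [twist, twist, h]

/-- A set `Z` of edges of `G` that twists the vertices of `CFI(G,∅)` over `v` into those of
`CFI(G,{u})`. -/
def TwistsAt (G : SimpleGraph V) (u : V) (Z : Finset (Sym2 V)) (v : V) : Prop :=
  (Z : Set (Sym2 V)) ⊆ G.edgeSet ∧ ((edgesAt Z v).card : ZMod 2) = if v = u then 1 else 0

lemma IsJoin.twistsAt {Z : Finset (Sym2 V)} {v w : V} (h : IsJoin G Z u w) (hv : w ≠ v) :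
    TwistsAt G u Z v :=
  ⟨h.1, by rw [h.2, if_neg hv.symm, add_zero]⟩

lemma TwistsAt.twist_subset {Z : Finset (Sym2 V)} {p : V × Finset (Sym2 V)}
    (h : TwistsAt G u Z p.1) (hp : (p.2 : Set (Sym2 V)) ⊆ G.incidenceSet p.1) :
    ((twist Z p).2 : Set (Sym2 V)) ⊆ G.incidenceSet p.1 := by
  intro e he
  rcases Finset.mem_symmDiff.1 he with he | he
  · exact hp he.1
  · have := Finset.mem_filter.1 he.1
    exact ⟨h.1 this.1, this.2⟩

lemma TwistsAt.modEq_iff {Z : Finset (Sym2 V)} {p : V × Finset (Sym2 V)}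
    (h : TwistsAt G u Z p.1) :
    (twist Z p).2.card ≡ ({p.1} ∩ {u} : Finset V).card [MOD 2] ↔
      p.2.card ≡ ({p.1} ∩ ∅ : Finset V).card [MOD 2] := by
  have hu : ((({p.1} ∩ {u} : Finset V).card : ℕ) : ZMod 2) = if p.1 = u then 1 else 0 := by
    by_cases hp : p.1 = u <;> simp [hp, Finset.singleton_inter_of_notMem]
  rw [← ZMod.natCast_eq_natCast_iff, ← ZMod.natCast_eq_natCast_iff, hu, twist,
    natCast_card_symmDiff, h.2]
  simp

/-- The bijection between the vertices of `CFI(G,∅)` and `CFI(G,{u})` that twists the vertices over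
`v` by `Z v`. -/
def twistEquiv (Z : V → Finset (Sym2 V)) (hZ : ∀ v, TwistsAt G u (Z v) v) :
    CFIVertex G ∅ ≃ CFIVertex G {u} where
  toFun x := ⟨twist (Z x.1.1) x.1, (hZ _).twist_subset x.2.1, (hZ _).modEq_iff.2 x.2.2⟩
  invFun y := ⟨twist (Z y.1.1) y.1, (hZ _).twist_subset y.2.1, by
    have h := hZ y.1.1
    refine (TwistsAt.modEq_iff (p := twist (Z y.1.1) y.1) h).1 ?_
    rw [twist_involutive]
    exact y.2.2⟩
  left_inv x := Subtype.ext (twist_involutive _ _)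
  right_inv y := Subtype.ext (twist_involutive _ _)

lemma isLocalIso_of_twist {k : ℕ} {U U' : Finset V} (Z : Finset (Sym2 V))
    {x : Fin k → CFIVertex G U} {y : Fin k → CFIVertex G U'}
    (h : ∀ i, (y i).1 = twist Z (x i).1) : IsLocalIso (CFI G U) (CFI G U') x y := by
  intro i j
  refine ⟨?_, ?_⟩
  · rw [Subtype.ext_iff, Subtype.ext_iff, h, h, (twist_involutive Z).injective.eq_iff]
  · change G.Adj _ _ ∧ _ ↔ G.Adj _ _ ∧ _
    rw [h, h]
    refine and_congr_right fun _ => not_congr ?_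
    simp only [twist, edgesAt, Finset.mem_symmDiff, Finset.mem_filter, Sym2.mem_mk_left,
      Sym2.mem_mk_right, and_true]
    tauto

/-- The vertices of the base graph over which the pebbles of a position lie. -/
def baseSet {k : ℕ} {U : Finset V} (x : Fin k → CFIVertex G U) : Finset V :=
  Finset.univ.image fun i => (x i).1.1

lemma baseSet_update {k : ℕ} {U : Finset V} (x : Fin k → CFIVertex G U) (i : Fin k)
    (v : CFIVertex G U) : baseSet (Function.update x i v) =
      insert v.1.1 ((Finset.univ.erase i).image fun j => (x j).1.1) := by
  rw [baseSet, ← Finset.insert_erase (Finset.mem_univ i), Finset.image_insert,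
    Function.update_self, Finset.erase_insert (Finset.notMem_erase i _)]
  refine congrArg _ (Finset.image_congr fun j hj => ?_)
  rw [Function.update_of_ne (Finset.ne_of_mem_erase hj)]

/-- Duplicator's bijection of the tuples of vertices. It maps a tuple to its twist by a set that
depends only on the vertices of the base graph under the tuple. -/
def tupleEquiv {k : ℕ} (Z : Finset V → V → Finset (Sym2 V))
    (hZ : ∀ X v, TwistsAt G u (Z X v) v) :
    (Fin k → CFIVertex G ∅) ≃ (Fin k → CFIVertex G {u}) where
  toFun x i := twistEquiv (Z (baseSet x)) (hZ _) (x i)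
  invFun y i := (twistEquiv (Z (baseSet y)) (hZ _)).symm (y i)
  left_inv x := funext fun i => (twistEquiv (Z (baseSet x)) (hZ _)).symm_apply_apply (x i)
  right_inv y := funext fun i => (twistEquiv (Z (baseSet y)) (hZ _)).apply_symm_apply (y i)

end Twist

/-! ### Duplicator's strategy -/

/-- Duplicator plays twists along joins from `u` to the robber's position, so that every position
is a twist by one such join. -/
theorem duplicatorWins_CFI_of_le_treewidth {V : Type*} [Fintype V] [DecidableEq V]
    (G : SimpleGraph V) (hG : G.Connected) (k : ℕ) (hk : 1 ≤ k) (htw : (k : ℕ∞) ≤ treewidth G)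
    (u : V) : DuplicatorWins k (CFI G ∅) (CFI G {u}) := by
  obtain ⟨β, hβ, hβr⟩ := exists_robber_of_le_treewidth hG hk htw
  have hjoin : ∀ X, ∃ Z, IsJoin G Z u (β X) := fun X =>
    let ⟨Z, hZ, _⟩ := (reachableAvoiding_empty_of_reachable (hG.preconnected u (β X))).exists_isJoin
    ⟨Z, hZ⟩
  choose J hJ using hjoin
  have hbase : ∀ (U : Finset V) (x : Fin k → CFIVertex G U), (baseSet x).card ≤ k := fun U x =>
    Finset.card_image_le.trans (by simp)
  have hsingle : ∀ v, β {v} ≠ v := fun v h =>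
    hβ {v} (by simpa using hk) (by simp [h])
  -- In the initial bijection, any admissible twist will do over the robber's position, which carries
  -- no pebbles.
  refine duplicatorWins_of_invariant _ _
    (fun x y => ∃ Z, IsJoin G Z u (β (baseSet x)) ∧ ∀ i, (y i).1 = twist Z (x i).1)
    (fun x y ⟨Z, _, hZ⟩ => isLocalIso_of_twist Z hZ)
    (tupleEquiv (fun X v => if v ≠ β X then J X else J {v}) fun X v => ?_)
    (fun x => ⟨J (baseSet x), hJ _, fun i => ?_⟩) ?_
  · split_ifs with h
    · exact (hJ X).twistsAt h.symm
    · exact (hJ {v}).twistsAt (hsingle v)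
  · have hi : (x i).1.1 ≠ β (baseSet x) := fun h =>
      hβ _ (hbase _ x) (h ▸ Finset.mem_image_of_mem _ (Finset.mem_univ i))
    change twist (if _ then _ else _) (x i).1 = _
    rw [if_pos hi]
  · rintro x y ⟨Z, hZ, hxy⟩ i
    set X' : Finset V := (Finset.univ.erase i).image fun j => (x j).1.1 with hX'
    have hX'k : ∀ v, (insert v X').card ≤ k := fun v => by
      have h₁ : X'.card ≤ k - 1 := Finset.card_image_le.trans (by simp)
      have h₂ := Finset.card_insert_le v X'
      omega
    have hsub : X' ⊆ baseSet x := Finset.image_subset_image (Finset.erase_subset _ _)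
    -- The robber runs to the position for the new pebbles, avoiding the pebbles that stay.
    have hrun : ∀ v, ∃ P, IsJoin G P (β (baseSet x)) (β (insert v X')) ∧
        ∀ w ∈ X', edgesAt P w = ∅ := fun v =>
      ReachableAvoiding.exists_isJoin (Relation.ReflTransGen.trans
        (hβr X' _ hsub (hbase _ x)).symm (hβr X' _ (Finset.subset_insert v X') (hX'k v)))
    choose P hP hPX using hrun
    refine ⟨twistEquiv (fun v => symmDiff Z (P v)) fun v => (hZ.symmDiff (hP v)).twistsAt fun h =>
      hβ _ (hX'k v) (by rw [h]; exact Finset.mem_insert_self _ _),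
      fun v => ⟨symmDiff Z (P v.1.1), ?_, ?_⟩⟩
    · rw [baseSet_update]
      exact hZ.symmDiff (hP v.1.1)
    · intro j
      by_cases hj : j = i
      · subst hj
        rw [Function.update_self, Function.update_self]
        rfl
      · rw [Function.update_of_ne hj, Function.update_of_ne hj, hxy]
        refine twist_congr ?_
        have hjX : (x j).1.1 ∈ X' := Finset.mem_image_of_mem _ (by simp [hj])
        rw [edgesAt_symmDiff, hPX _ _ hjX]
        exact (symmDiff_bot _).symm

end CFIGame

theorem mainTheorem3 {V : Type*} [Fintype V] [DecidableEq V] (G : SimpleGraph V)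
    (hG : G.Connected) (k : ℕ) (hk : 1 ≤ k) (htw : (k : ℕ∞) ≤ CFIGame.treewidth G) (u : V) :
    CFIGame.DuplicatorWins k (CFIGame.CFI G ∅) (CFIGame.CFI G {u}) :=
  CFIGame.duplicatorWins_CFI_of_le_treewidth G hG k hk htw u
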